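/- Let $\omega^*=\beta\omega\setminus\omega$ be the Čech–Stone remainder of the countable discrete space $\omega$, and let $\mathfrak c=2^{\aleph_0}$. A space is called crowded if it has no isolated points. For a space $X$ let $CR(X)$ be the collection of all non-empty subspaces of $X$ that are crowded. A family $\mathcal U$ of subsets of $X$ is said to $T_3$-split $CR(X)$ if for every $S\in CR(X)$ there are $U_0,U_1\in\mathcal U$ such that $\overline{U_0}\cap\overline{U_1}=\emptyset$, $U_0\cap S\neq\emptyset$ and $U_1\cap S\neq\emptyset$. If some family of open subsets of $X$ $T_3$-splits $CR(X)$, the $T_3$-crowded splitting number of $X$ is the least cardinality of such a family. The weight of a space is the least cardinality of an open base of it. A continuous map $f:X\to Y$ is crowdedness preserving (CP) if $f[S]$ is crowded for every crowded subspace $S$ of $X$. **Theorem.** There is a family of open subsets of $\omega^*$ that $T_3$-splits $CR(\omega^*)$, and the $T_3$-crowded splitting number of $\omega^*$ is equal to $\mathfrak c$. Moreover, whenever $Y$ is a Hausdorff space and $f:\omega^*\to Y$ is a CP map from $\omega^*$ onto $Y$, the weight of $Y$ is equal to $\mathfrak c$. -/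

import Mathlib

/-- The Čech–Stone remainder `ω* = βω \ ω` of the discrete space `ω`, with the subspace topology.
Here `βω` is `Ultrafilter ℕ` with its Stone–Čech topology (basic open sets `{p | A ∈ p}`), and
`n : ℕ` sits in `βω` as the principal ultrafilter `pure n`. -/
abbrev OmegaStar : Type := {p : Ultrafilter ℕ // p ∉ Set.range (pure : ℕ → Ultrafilter ℕ)}

/-- `CR(X)`: the non-empty crowded subspaces of `X`, i.e. the non-empty subsets of `X` that have
no isolated point in the subspace topology (Mathlib's `Preperfect`). -/
def crowdedSubspaces (X : Type*) [TopologicalSpace X] : Set (Set X) :=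
  {S | S.Nonempty ∧ Preperfect S}

/-- The family `A` `T₃`-splits the family `B`: each member of `B` meets two members of `A` that
have disjoint closures. -/
def T3Splits {X : Type*} [TopologicalSpace X] (A B : Set (Set X)) : Prop :=
  ∀ S ∈ B, ∃ A₀ ∈ A, ∃ A₁ ∈ A,
    Disjoint (closure A₀) (closure A₁) ∧ (A₀ ∩ S).Nonempty ∧ (A₁ ∩ S).Nonempty

/-- `U` is a family of open sets of `X` that `T₃`-splits `CR(X)`. -/
def IsOpenT3CrowdedSplitting {X : Type*} [TopologicalSpace X] (U : Set (Set X)) : Prop :=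
  (∀ G ∈ U, IsOpen G) ∧ T3Splits U (crowdedSubspaces X)

/-- The `T₃`-crowded splitting number of `X`: the least cardinality of a family of open sets
that `T₃`-splits `CR(X)` (meaningful when there is such a family; the value is `0` otherwise). -/
noncomputable def t3CrowdedSplittingNumber (X : Type*) [TopologicalSpace X] : Cardinal :=
  sInf {κ | ∃ U : Set (Set X), IsOpenT3CrowdedSplitting U ∧ Cardinal.mk U = κ}

/-- The weight of `X`: the least cardinality of an open base. -/
noncomputable def topWeight (X : Type*) [TopologicalSpace X] : Cardinal :=
  sInf {κ | ∃ B : Set (Set X), TopologicalSpace.IsTopologicalBasis B ∧ Cardinal.mk B = κ}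

/-- A crowdedness preserving (CP) map: a continuous map for which the image of every crowded
subspace is crowded. -/
def IsCrowdednessPreserving {X Y : Type*} [TopologicalSpace X] [TopologicalSpace Y]
    (f : X → Y) : Prop :=
  Continuous f ∧ ∀ S : Set X, Preperfect S → Preperfect (f '' S)

open Set Filter Topology TopologicalSpace
open Cardinal hiding univ

/-! ### The Cantor cube `T → Bool` -/

section CantorCube

variable {T : Type*}

/-! The lower bound comes from a continuous surjection `g` of `ω*` onto the separable cube `2^𝔠`.
Fix fewer than `𝔠` open sets and a closed `K` on which `g` is irreducible. For a pair with disjoint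
closures, the open sets of points with no preimage in `K` lying in the one, resp. the other, closure
have dense union (`IsIrreducibleOnto.dense_union`). Separability shrinks both to sets with countable
support. Baire category picks one side per pair, consistently on finite subfamilies; coordinates
outside all supports stay free, so the part of `K` avoiding the chosen sides still maps onto an
infinite cube and contains a crowded set that no pair splits. The clopen sets `starSet A` give the
upper bounds, and preimages of a base under a CP map form a splitting family. -/

theorem IsOpen.exists_finset_forall_eq_mem {O : Set (T → Bool)} (hO : IsOpen O) {x : T → Bool}
    (hx : x ∈ O) : ∃ s : Finset T, ∀ y : T → Bool, (∀ i ∈ s, y i = x i) → y ∈ O := by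
  obtain ⟨s, u, hu, hs⟩ := isOpen_pi_iff.1 hO x hx
  exact ⟨s, fun y hy => hs fun i hi => by rw [hy i hi]; exact (hu i hi).2⟩

theorem isOpen_setOf_forall_finset_eq (s : Finset T) (x : T → Bool) :
    IsOpen {y : T → Bool | ∀ i ∈ s, y i = x i} := by
  have : {y : T → Bool | ∀ i ∈ s, y i = x i} = ⋂ i ∈ s, {y | y i = x i} := by ext; simp
  rw [this]
  exact isOpen_biInter_finset fun i _ => 
    (isOpen_discrete ({x i} : Set Bool)).preimage (continuous_apply (A := fun _ => Bool) i)

instance cantorCube_nhdsNE_neBot [Infinite T] (x : T → Bool) : NeBot (𝓝[≠] x) := by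
  classical
  rw [← mem_closure_iff_nhdsWithin_neBot, mem_closure_iff]
  intro O hO hx
  obtain ⟨s, hs⟩ := hO.exists_finset_forall_eq_mem hx
  obtain ⟨i, hi⟩ := Infinite.exists_notMem_finset s
  refine ⟨Function.update x i (!x i), hs _ fun j hj => ?_, fun h => ?_⟩
  · exact Function.update_of_ne (by rintro rfl; exact hi hj) _ _
  · simpa using congrFun h i

/-- A special case of the Hewitt–Marczewski–Pondiczery theorem. -/
instance cantorCube_separableSpace : SeparableSpace ((ℕ → Bool) → Bool) := by
  let d : (Σ n, (Fin n → Bool) → Bool) → (ℕ → Bool) → Bool := fun p x => p.2 fun i => x i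
  suffices h : DenseRange d from ⟨range d, countable_range d, h⟩
  refine dense_iff_inter_open.2 fun O hO ⟨x, hx⟩ => ?_
  obtain ⟨s, hs⟩ := hO.exists_finset_forall_eq_mem hx
  have key : ∃ n : ℕ, ∀ a ∈ s, ∀ b ∈ s, (∀ i < n, a i = b i) → a = b := by
    have (p : (ℕ → Bool) × (ℕ → Bool)) : ∃ n : ℕ, (∀ i < n, p.1 i = p.2 i) → p.1 = p.2 := by
      by_cases h : p.1 = p.2
      · exact ⟨0, fun _ => h⟩
      · obtain ⟨i, hi⟩ := Function.ne_iff.1 h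
        exact ⟨i + 1, fun h => absurd (h i i.lt_succ_self) hi⟩
    choose N hN using this
    refine ⟨(s ×ˢ s).sup N, fun a ha b hb h => hN (a, b) fun i hi => h i (hi.trans_le ?_)⟩
    exact Finset.le_sup (f := N) (Finset.mk_mem_product ha hb)
  obtain ⟨n, hn⟩ := key
  classical
  -- The first `n` coordinates separate the points of `s`, so a function of them can copy `x` on
  -- `s`.
  refine ⟨_, hs (d ⟨n, fun h => decide (∃ a ∈ s, (∀ i : Fin n, a i = h i) ∧ x a = true)⟩) ?_,
    mem_range_self _⟩
  intro b hb
  rw [Bool.eq_iff_iff]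
  simp only [d, decide_eq_true_eq]
  constructor
  · rintro ⟨a, ha, hab, hxa⟩
    rwa [← hn a ha b hb fun i hi => hab ⟨i, hi⟩]
  · exact fun h => ⟨b, hb, fun _ => rfl, h⟩

/-- In a separable Cantor cube every open set has a dense open subset which is determined by
countably many coordinates. -/
theorem IsOpen.exists_subset_countable_support [SeparableSpace (T → Bool)] {O : Set (T → Bool)}
    (hO : IsOpen O) : ∃ (D : Set T) (V : Set (T → Bool)), D.Countable ∧ IsOpen V ∧ V ⊆ O ∧
      O ⊆ closure V ∧ ∀ x y : T → Bool, (∀ i ∈ D, y i = x i) → x ∈ V → y ∈ V := by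
  obtain ⟨Q, hQc, hQd⟩ := exists_countable_dense (T → Bool)
  have (q : T → Bool) : ∃ s : Finset T,
      q ∈ O → ∀ y : T → Bool, (∀ i ∈ s, y i = q i) → y ∈ O := by
    by_cases hq : q ∈ O
    · obtain ⟨s, hs⟩ := hO.exists_finset_forall_eq_mem hq
      exact ⟨s, fun _ => hs⟩
    · exact ⟨∅, fun h => absurd h hq⟩
  choose s hs using this
  refine ⟨⋃ q ∈ Q, ↑(s q), ⋃ q ∈ Q ∩ O, {y | ∀ i ∈ s q, y i = q i},
    hQc.biUnion fun q _ => (s q).countable_toSet,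
    isOpen_biUnion fun q _ => isOpen_setOf_forall_finset_eq _ _, ?_, ?_, ?_⟩
  · exact iUnion₂_subset fun q hq y hy => hs q hq.2 y hy
  · have h1 : O ⊆ closure (Q ∩ O) := by
      rw [inter_comm]; exact hQd.open_subset_closure_inter hO
    refine h1.trans (closure_mono fun q hq => ?_)
    exact mem_biUnion hq fun i _ => rfl
  · intro x y hxy hx
    simp only [mem_iUnion] at hx ⊢
    obtain ⟨q, hq, hx⟩ := hx
    exact ⟨q, hq, fun i hi => (hxy i (mem_biUnion hq.1 hi)).trans (hx i hi)⟩

end CantorCube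

/-! ### Closed sets minimal with respect to mapping onto a space -/

/-- `K` is a minimal element among the closed sets that `f` maps onto the whole space. -/
structure IsIrreducibleOnto {Z A : Type*} [TopologicalSpace Z] (f : Z → A) (K : Set Z) :
    Prop where
  isClosed : IsClosed K
  image_eq : f '' K = univ
  eq_of_subset : ∀ L ⊆ K, IsClosed L → f '' L = univ → L = K

/-- If an open `W` lay in both images, `K ∩ C` together with the part of `K` not over `W` would
still map onto `A`, hence equal `K`; but it misses the points of `K ∩ D` over `W`. -/
theorem IsIrreducibleOnto.dense_union {Z A : Type*} [TopologicalSpace Z]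
    [TopologicalSpace A] {f : Z → A} (hf : Continuous f) {K : Set Z}
    (hK : IsIrreducibleOnto f K) {C D : Set Z} (hC : IsClosed C) (hCD : Disjoint C D) :
    Dense ((f '' (K ∩ C))ᶜ ∪ (f '' (K ∩ D))ᶜ) := by
  refine dense_iff_inter_open.2 fun W hW ⟨a, ha⟩ => ?_
  by_contra hcon
  have hWC : W ⊆ f '' (K ∩ C) := fun w hw => by_contra fun h => hcon ⟨w, hw, Or.inl h⟩
  have hWD : W ⊆ f '' (K ∩ D) := fun w hw => by_contra fun h => hcon ⟨w, hw, Or.inr h⟩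
  have hL : IsClosed ((K \ f ⁻¹' W) ∪ (K ∩ C)) :=
    (hK.isClosed.sdiff (hW.preimage hf)).union (hK.isClosed.inter hC)
  have hLs : f '' ((K \ f ⁻¹' W) ∪ (K ∩ C)) = univ := eq_univ_of_forall fun b => by
    by_cases hb : b ∈ W
    · exact image_mono subset_union_right (hWC hb)
    · obtain ⟨z, hz, rfl⟩ : b ∈ f '' K := hK.image_eq ▸ mem_univ b
      exact ⟨z, Or.inl ⟨hz, hb⟩, rfl⟩
  have hLK := hK.eq_of_subset _ (union_subset sdiff_subset inter_subset_left) hL hLs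
  obtain ⟨z, ⟨hzK, hzD⟩, rfl⟩ := hWD ha
  rcases hLK.symm.subset hzK with h | h
  · exact h.2 ha
  · exact hCD.notMem_of_mem_left h.2 hzD

section Irreducible

variable {Z A : Type*} [TopologicalSpace Z] [CompactSpace Z] [TopologicalSpace A] [T2Space A]
  {f : Z → A}

theorem exists_isIrreducibleOnto (hf : Continuous f) {F : Set Z} (hF : IsClosed F)
    (hFs : f '' F = univ) : ∃ K ⊆ F, IsIrreducibleOnto f K := by
  obtain ⟨K, hKF, hK⟩ := zorn_superset_nonempty {L : Set Z | IsClosed L ∧ f '' L = univ}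
    (fun c hc hchain hne => by
      refine ⟨⋂₀ c, ⟨isClosed_sInter fun L hL => (hc hL).1, ?_⟩, fun L hL => sInter_subset_of_mem hL⟩
      refine eq_univ_of_forall fun a => ?_
      have : Nonempty c := hne.to_subtype
      have h := IsCompact.nonempty_iInter_of_directed_nonempty_isCompact_isClosed
        (fun L : c => (L : Set Z) ∩ f ⁻¹' {a})
        (fun L M => by
          rcases hchain.total L.2 M.2 with h | h
          · exact ⟨L, Subset.rfl, inter_subset_inter_left _ h⟩
          · exact ⟨M, inter_subset_inter_left _ h, Subset.rfl⟩)
        (fun L => by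
          obtain ⟨z, hz, hza⟩ : a ∈ f '' (L : Set Z) := (hc L.2).2 ▸ mem_univ a
          exact ⟨z, hz, hza⟩)
        (fun L => ((hc L.2).1.inter (isClosed_singleton.preimage hf)).isCompact)
        (fun L => (hc L.2).1.inter (isClosed_singleton.preimage hf))
      obtain ⟨z, hz⟩ := h
      rw [mem_iInter] at hz
      exact ⟨z, fun L hL => (hz ⟨L, hL⟩).1, (hz (Classical.arbitrary c)).2⟩)
    F ⟨hF, hFs⟩
  exact ⟨K, hKF, hK.prop.1, hK.prop.2, fun L hLK hL hLs => hK.eq_of_subset ⟨hL, hLs⟩ hLK⟩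

/-- Removing an isolated point `x` from `K` could uncover only `f x`, making `{f x}` open. -/
theorem IsIrreducibleOnto.preperfect [∀ a : A, NeBot (𝓝[≠] a)] (hf : Continuous f) {K : Set Z}
    (hK : IsIrreducibleOnto f K) : Preperfect K := by
  rw [preperfect_iff_nhds]
  intro x hx U hU
  by_contra! hcon
  obtain ⟨O, hOU, hO, hxO⟩ := mem_nhds_iff.1 hU
  have hL : IsClosed (K \ O) := hK.isClosed.sdiff hO
  have hne : f '' (K \ O) ≠ univ := fun h =>
    ((hK.eq_of_subset _ sdiff_subset hL h).symm.subset hx).2 hxO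
  have hopen : IsOpen (f '' (K \ O))ᶜ := (hL.isCompact.image hf).isClosed.isOpen_compl
  have hsub : (f '' (K \ O))ᶜ ⊆ {f x} := fun a ha => by
    obtain ⟨z, hz, rfl⟩ : a ∈ f '' K := hK.image_eq ▸ mem_univ a
    by_cases hzO : z ∈ O
    · rw [hcon z ⟨hOU hzO, hz⟩]; rfl
    · exact absurd ⟨z, ⟨hz, hzO⟩, rfl⟩ ha
  have hnonempty := nonempty_compl.2 hne
  rw [hnonempty.subset_singleton_iff.1 hsub] at hopen
  exact not_isOpen_singleton (f x) hopen

end Irreducible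

/-! ### Small families of open sets do not split -/

theorem infinite_compl_iUnion_of_countable {ι T : Type} {D : ι → Set T}
    (hD : ∀ i, (D i).Countable) (hι : #ι < #T) (hT : ℵ₀ < #T) :
    ((⋃ i, D i)ᶜ).Infinite := by
  intro hfin
  have h1 : #(⋃ i, D i) ≤ #ι * ℵ₀ :=
    (mk_iUnion_le D).trans (mul_le_mul_right (ciSup_le' fun i => (hD i).le_aleph0) _)
  have h3 : #(⋃ i, D i) < #T := h1.trans_lt (mul_lt_of_lt hT.le hι hT)
  have h4 := mk_sum_compl (⋃ i, D i)
  refine (add_lt_of_lt hT.le h3 (hfin.lt_aleph0.trans hT)).ne h4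

theorem exists_crowded_forall_disjoint {Z T : Type} [TopologicalSpace Z] [CompactSpace Z]
    [SeparableSpace (T → Bool)] {g : Z → T → Bool} (hg : Continuous g)
    (hgs : Function.Surjective g) (hT : ℵ₀ < #T) {𝒰 : Set (Set Z)} (hU : ∀ U ∈ 𝒰, IsOpen U)
    (hcard : #𝒰 < #T) :
    ∃ S ∈ crowdedSubspaces Z, ∀ U ∈ 𝒰, ∀ V ∈ 𝒰, Disjoint (closure U) (closure V) →
      Disjoint U S ∨ Disjoint V S := by
  classical
  obtain ⟨K, -, hK⟩ := exists_isIrreducibleOnto hg isClosed_univ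
    (image_univ_of_surjective hgs)
  let P := {p : 𝒰 × 𝒰 // Disjoint (closure (p.1 : Set Z)) (closure (p.2 : Set Z))}
  let U : P → Bool → Set Z := fun p b => if b then p.1.1 else p.1.2
  have hUo (p b) : IsOpen (U p b) := by
    cases b
    · exact hU _ p.1.2.2
    · exact hU _ p.1.1.2
  have hO (p b) : IsOpen (g '' (K ∩ closure (U p b)))ᶜ :=
    ((hK.isClosed.inter isClosed_closure).isCompact.image hg).isClosed.isOpen_compl
  choose D V hDc hVo hVO hOV hVD using fun p b => (hO p b).exists_subset_countable_support
  have hdense (p) : V p true ∪ V p false ∈ residual (T → Bool) := by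
    refine residual_of_dense_open ((hVo p true).union (hVo p false)) ?_
    have h := hK.dense_union hg (C := closure (U p true)) isClosed_closure p.2
    rw [← dense_closure, closure_union]
    exact h.mono (union_subset_union (hOV p true) (hOV p false))
  have : NeBot (residual (T → Bool)) := by
    refine neBot_iff.2 fun h => ?_
    obtain ⟨x, hx⟩ := (dense_of_mem_residual (h ▸ mem_bot : ∅ ∈ residual (T → Bool))).nonempty
    exact hx
  -- An ultrafilter of sets containing the residual ones makes the choices of sides finitely
  -- compatible.
  let 𝒱 : Ultrafilter (T → Bool) := Ultrafilter.of (residual (T → Bool))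
  have hε (p) : ∃ b, V p b ∈ 𝒱 := by
    rcases Ultrafilter.union_mem_iff.1 (Ultrafilter.of_le _ (hdense p)) with h | h
    exacts [⟨_, h⟩, ⟨_, h⟩]
  choose ε hε using hε
  let J : Set T := (⋃ p : P × Bool, D p.1 p.2)ᶜ
  have hP : #(P × Bool) < #T := by
    have : #P ≤ #𝒰 * #𝒰 := by
      rw [mul_def]; exact mk_subtype_le _
    rw [← mul_def]
    refine mul_lt_of_lt hT.le (this.trans_lt (mul_lt_of_lt hT.le hcard hcard)) ?_
    exact (lt_aleph0_of_finite Bool).trans hT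
  have hJ : J.Infinite :=
    infinite_compl_iUnion_of_countable (fun p => hDc p.1 p.2) hP hT
  have : Infinite J := hJ.to_subtype
  let r : Z → J → Bool := fun z => J.domRestrict (g z)
  have hr : Continuous r := continuous_pi fun j => (continuous_apply j.1).comp hg
  have hF : IsClosed (K ∩ ⋂ p, (U p (ε p))ᶜ) :=
    hK.isClosed.inter (isClosed_iInter fun p => (hUo p _).isClosed_compl)
  have hFr : r '' (K ∩ ⋂ p, (U p (ε p))ᶜ) = univ := eq_univ_of_forall fun a => by
    have hKa : IsCompact (K ∩ r ⁻¹' {a}) :=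
      (hK.isClosed.inter (isClosed_singleton.preimage hr)).isCompact
    obtain ⟨z, ⟨hzK, hza⟩, hz⟩ := hKa.inter_iInter_nonempty (fun p => (U p (ε p))ᶜ)
      (fun p => (hUo p _).isClosed_compl) fun u => by
        have hmem : (⋂ p ∈ u, V p (ε p)) ∈ 𝒱 :=
          (biInter_finset_mem u).2 fun p _ => hε p
        obtain ⟨w, hw⟩ := Ultrafilter.nonempty_of_mem hmem
        -- Overwriting `w` on `J` touches no support, so `w'` stays in the chosen sets `V p (ε p)`.
        let w' : T → Bool := fun t => if h : t ∈ J then a ⟨t, h⟩ else w t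
        obtain ⟨z, hzK, hz⟩ : w' ∈ g '' K := hK.image_eq ▸ mem_univ w'
        refine ⟨z, ⟨hzK, ?_⟩, mem_iInter₂.2 fun p hp hzU => ?_⟩
        · ext j
          simp [r, hz, w']
        · have hw' : w' ∈ V p (ε p) := by
            refine hVD p _ w w' (fun i hi => dif_neg fun h => h ?_) (mem_iInter₂.1 hw p hp)
            exact mem_iUnion.2 ⟨(p, ε p), hi⟩
          exact hVO p _ hw' ⟨z, ⟨hzK, subset_closure hzU⟩, hz⟩
    exact ⟨z, ⟨hzK, hz⟩, hza⟩
  obtain ⟨S, hSF, hS⟩ := exists_isIrreducibleOnto hr hF hFr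
  refine ⟨S, ⟨?_, hS.preperfect hr⟩, fun A hA B hB hAB => ?_⟩
  · exact image_nonempty.1 (hS.image_eq ▸ univ_nonempty)
  · let p : P := ⟨(⟨A, hA⟩, ⟨B, hB⟩), hAB⟩
    have h : Disjoint (U p (ε p)) S :=
      disjoint_right.2 fun z hz => mem_iInter.1 (hSF hz).2 p
    cases hb : ε p
    · rw [hb] at h; exact Or.inr h
    · rw [hb] at h; exact Or.inl h

/-! ### The space `ω*` -/

/-- The clopen subset of `ω*` determined by `A ⊆ ω`. -/
def starSet (A : Set ℕ) : Set OmegaStar := {p | A ∈ p.1}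

theorem isOpen_starSet (A : Set ℕ) : IsOpen (starSet A) :=
  (ultrafilter_isOpen_basic A).preimage continuous_subtype_val

theorem isClosed_starSet (A : Set ℕ) : IsClosed (starSet A) :=
  (ultrafilter_isClosed_basic A).preimage continuous_subtype_val

theorem exists_starSet_subset {O : Set OmegaStar} (hO : IsOpen O) {p : OmegaStar} (hp : p ∈ O) :
    ∃ A, p ∈ starSet A ∧ starSet A ⊆ O := by
  obtain ⟨W, hW, rfl⟩ := isOpen_induced_iff.1 hO
  obtain ⟨_, ⟨A, rfl⟩, hA, hAW⟩ := ultrafilterBasis_is_basis.exists_subset_of_mem_open hp hW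
  exact ⟨A, hA, fun q hq => hAW hq⟩

instance : CompactSpace OmegaStar := by
  refine isCompact_iff_compactSpace.1 (IsClosed.isCompact (s := {p | p ∉ range pure}) ?_)
  rw [← isOpen_compl_iff, compl_ofPred]
  have : {p : Ultrafilter ℕ | ¬ p ∉ range pure} = ⋃ n : ℕ, {p | {n} ∈ p} := by
    ext p
    simp only [mem_ofPred_eq, not_not, mem_iUnion, mem_range]
    refine exists_congr fun n => ⟨?_, fun h => ?_⟩
    · rintro rfl; exact mem_singleton n
    · exact (Ultrafilter.coe_le_coe.1 (by simpa using h)).symm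
  rw [this]
  exact isOpen_iUnion fun n => ultrafilter_isOpen_basic {n}

/-- Every non-empty separable compact Hausdorff space without isolated points is a continuous
image of `ω*`. -/
theorem exists_continuous_surjective_omegaStar (X : Type*) [TopologicalSpace X] [CompactSpace X]
    [T2Space X] [SeparableSpace X] [Nonempty X] [∀ x : X, NeBot (𝓝[≠] x)] :
    ∃ g : OmegaStar → X, Continuous g ∧ Function.Surjective g := by
  let u := denseSeq X
  refine ⟨fun p => Ultrafilter.extend u p.1,
    (continuous_ultrafilter_extend u).comp continuous_subtype_val, fun x => ?_⟩
  have hne : NeBot (comap u (𝓝 x) ⊓ cofinite) := by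
    rw [inf_neBot_iff]
    intro s hs t ht
    obtain ⟨W, hW, hWs⟩ := mem_comap.1 hs
    -- Without isolated points, finitely many terms can be dropped; this makes the ultrafilter below
    -- free.
    have hd : Dense (range u \ u '' tᶜ) :=
      (denseRange_denseSeq X).sdiff_finite ((mem_cofinite.1 ht).image u)
    obtain ⟨_, hyW, ⟨n, rfl⟩, hn⟩ := mem_closure_iff_nhds.1 (hd x) W hW
    exact ⟨n, hWs hyW, by_contra fun h => hn ⟨n, h, rfl⟩⟩
  let p := Ultrafilter.of (comap u (𝓝 x) ⊓ cofinite)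
  have hp : (p : Filter ℕ) ≤ comap u (𝓝 x) ⊓ cofinite := Ultrafilter.of_le _
  refine ⟨⟨p, ?_⟩, ?_⟩
  · rintro ⟨n, hn⟩
    have h : {n}ᶜ ∈ p := hp.trans inf_le_right (finite_singleton n).compl_mem_cofinite
    rw [← hn] at h
    exact h rfl
  · exact ultrafilter_extend_eq_iff.2 (map_le_iff_le_comap.2 (hp.trans inf_le_left))

theorem continuum_le_mk_of_isOpenT3CrowdedSplitting {𝒰 : Set (Set OmegaStar)}
    (h : IsOpenT3CrowdedSplitting 𝒰) : 𝔠 ≤ #𝒰 := by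
  have hT : #(ℕ → Bool) = 𝔠 := by simp
  obtain ⟨g, hg, hgs⟩ := exists_continuous_surjective_omegaStar ((ℕ → Bool) → Bool)
  by_contra! hlt
  obtain ⟨S, hS, hdisj⟩ := exists_crowded_forall_disjoint hg hgs (hT ▸ aleph0_lt_continuum) h.1
    (hT ▸ hlt)
  obtain ⟨A, hA, B, hB, hAB, hAS, hBS⟩ := h.2 S hS
  rcases hdisj A hA B hB hAB with h | h
  · exact not_disjoint_iff_nonempty_inter.2 hAS h
  · exact not_disjoint_iff_nonempty_inter.2 hBS h

theorem isOpenT3CrowdedSplitting_range_starSet : IsOpenT3CrowdedSplitting (range starSet) := by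
  refine ⟨forall_mem_range.2 isOpen_starSet, fun S ⟨⟨p, hp⟩, hS⟩ => ?_⟩
  obtain ⟨q, ⟨-, hq⟩, hqp⟩ := preperfect_iff_nhds.1 hS p hp univ univ_mem
  obtain ⟨A, hpA, hqA⟩ := exists_starSet_subset isOpen_compl_singleton hqp.symm
  have hqA' : A ∉ q.1 := fun h => hqA (show q ∈ starSet A from h) rfl
  refine ⟨_, mem_range_self A, _, mem_range_self Aᶜ, ?_, ⟨p, hpA, hp⟩,
    ⟨q, Ultrafilter.compl_mem_iff_notMem.2 hqA', hq⟩⟩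
  rw [(isClosed_starSet _).closure_eq, (isClosed_starSet _).closure_eq]
  exact disjoint_left.2 fun r hr hr' => Ultrafilter.compl_mem_iff_notMem.1 hr' hr

theorem t3CrowdedSplittingNumber_omegaStar : t3CrowdedSplittingNumber OmegaStar = 𝔠 := by
  refine le_antisymm ?_ (le_csInf ⟨_, _, isOpenT3CrowdedSplitting_range_starSet, rfl⟩ ?_)
  · refine (show t3CrowdedSplittingNumber OmegaStar ≤ #(range starSet) from
      csInf_le' ⟨_, isOpenT3CrowdedSplitting_range_starSet, rfl⟩).trans ?_
    simpa using mk_range_le (f := starSet)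
  · rintro _ ⟨𝒰, h𝒰, rfl⟩
    exact continuum_le_mk_of_isOpenT3CrowdedSplitting h𝒰

/-! ### Images of `ω*` -/

section Image

variable {Y : Type*} [TopologicalSpace Y] [T2Space Y] {f : OmegaStar → Y}

theorem exists_starSet_between {C O : Set OmegaStar} (hC : IsClosed C) (hO : IsOpen O)
    (hCO : C ⊆ O) : ∃ A, C ⊆ starSet A ∧ starSet A ⊆ O := by
  refine hC.isCompact.induction_on (p := fun s => ∃ A, s ⊆ starSet A ∧ starSet A ⊆ O)
    ⟨∅, empty_subset _, fun p hp => absurd hp p.1.empty_notMem⟩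
    (fun s t hst ⟨A, hA, hAO⟩ => ⟨A, hst.trans hA, hAO⟩) ?_ ?_
  · rintro s t ⟨A, hA, hAO⟩ ⟨B, hB, hBO⟩
    have : starSet (A ∪ B) = starSet A ∪ starSet B := by
      ext p; exact Ultrafilter.union_mem_iff
    exact ⟨A ∪ B, this ▸ union_subset_union hA hB, this ▸ union_subset hAO hBO⟩
  · intro p hp
    obtain ⟨A, hpA, hAO⟩ := exists_starSet_subset hO (hCO hp)
    exact ⟨starSet A, mem_nhdsWithin_of_mem_nhds ((isOpen_starSet A).mem_nhds hpA), A,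
      Subset.rfl, hAO⟩

/-- Compactness fits a clopen `starSet A` between `f ⁻¹' Oᶜ` and the complement of the fibre of `y`;
the complement of its image is then a neighbourhood of `y` inside `O`. -/
theorem isTopologicalBasis_range_compl_image_starSet (hf : Continuous f)
    (hfs : Function.Surjective f) : IsTopologicalBasis (range fun A => (f '' starSet A)ᶜ) := by
  refine isTopologicalBasis_of_isOpen_of_nhds (forall_mem_range.2 fun A => ?_)
    fun y O hy hO => ?_
  · exact ((isClosed_starSet A).isCompact.image hf).isClosed.isOpen_compl
  · obtain ⟨A, hA, hAy⟩ := exists_starSet_between (hO.isClosed_compl.preimage hf)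
      ((isOpen_compl_singleton (x := y)).preimage hf) fun p hp (h : f p = y) => hp (h ▸ hy)
    refine ⟨_, mem_range_self A, ?_, fun z hz => by_contra fun hzO => hz ?_⟩
    · rintro ⟨p, hp, hpy⟩
      exact hAy hp hpy
    · obtain ⟨p, rfl⟩ := hfs z
      exact mem_image_of_mem f (hA hzO)

theorem topWeight_le_continuum (hf : Continuous f) (hfs : Function.Surjective f) :
    topWeight Y ≤ 𝔠 := by
  refine (show topWeight Y ≤ #(range fun A => (f '' starSet A)ᶜ) from
    csInf_le' ⟨_, isTopologicalBasis_range_compl_image_starSet hf hfs, rfl⟩).trans ?_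
  have := mk_range_le_lift (f := fun A : Set ℕ => (f '' starSet A)ᶜ)
  simpa using this

/-- The preimages of the members of a base under a CP map split the crowded subspaces. -/
theorem IsCrowdednessPreserving.isOpenT3CrowdedSplitting_preimage
    (hf : IsCrowdednessPreserving f) (hfs : Function.Surjective f) {B : Set (Set Y)}
    (hB : IsTopologicalBasis B) : IsOpenT3CrowdedSplitting ((fun O => f ⁻¹' O) '' B) := by
  have : CompactSpace Y := hfs.compactSpace hf.1
  refine ⟨forall_mem_image.2 fun O hO => (hB.isOpen hO).preimage hf.1, fun S ⟨⟨p, hp⟩, hS⟩ => ?_⟩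
  obtain ⟨_, ⟨-, q, hq, rfl⟩, hqp⟩ :=
    preperfect_iff_nhds.1 (hf.2 S hS) (f p) (mem_image_of_mem f hp) univ univ_mem
  -- Compact Hausdorff `Y` separates points by open sets with disjoint closures.
  obtain ⟨V, hpV, hV, W, hqW, hW, hVW⟩ := exists_open_nhds_disjoint_closure hqp.symm
  obtain ⟨V', hV'B, hpV', hV'⟩ := hB.exists_subset_of_mem_open hpV hV
  obtain ⟨W', hW'B, hqW', hW'⟩ := hB.exists_subset_of_mem_open hqW hW
  refine ⟨_, mem_image_of_mem _ hV'B, _, mem_image_of_mem _ hW'B, ?_, ⟨p, hpV', hp⟩,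
    ⟨q, hqW', hq⟩⟩
  exact (hVW.preimage f).mono
    ((hf.1.closure_preimage_subset _).trans (preimage_mono (closure_mono hV')))
    ((hf.1.closure_preimage_subset _).trans (preimage_mono (closure_mono hW')))

theorem IsCrowdednessPreserving.continuum_le_topWeight (hf : IsCrowdednessPreserving f)
    (hfs : Function.Surjective f) : 𝔠 ≤ topWeight Y := by
  refine le_csInf ⟨_, _, isTopologicalBasis_opens, rfl⟩ ?_
  rintro _ ⟨B, hB, rfl⟩
  have h1 := continuum_le_mk_of_isOpenT3CrowdedSplitting
    (hf.isOpenT3CrowdedSplitting_preimage hfs hB)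
  have h2 := mk_image_le_lift (f := fun O => f ⁻¹' O) (s := B)
  have h3 := (lift_le.2 h1).trans h2
  simpa using h3

end Image

theorem mainTheorem11 :
    (∃ U : Set (Set OmegaStar), IsOpenT3CrowdedSplitting U) ∧
    t3CrowdedSplittingNumber OmegaStar = Cardinal.continuum ∧
    ∀ (Y : Type*) [TopologicalSpace Y] [T2Space Y] (f : OmegaStar → Y),
      IsCrowdednessPreserving f → Function.Surjective f →
        topWeight Y = Cardinal.continuum :=
  ⟨⟨_, isOpenT3CrowdedSplitting_range_starSet⟩, t3CrowdedSplittingNumber_omegaStar,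
    fun _ _ _ _ hf hfs =>
      (topWeight_le_continuum hf.1 hfs).antisymm (hf.continuum_le_topWeight hfs)⟩
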